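/- Let $\Delta$ be a finite non-degenerate polar space of rank $n>2$ and order $(s,\dots,s,t)$, where $s>1$ and $t$ are positive integers with $t\in\{1,s^{1/2},s,s^{3/2},s^2\}$; that is, every line has $s+1$ points and every singular subspace of dimension $n-2$ lies in exactly $t+1$ singular subspaces of dimension $n-1$. For $0\le i\le n-1$ let $\Delta_i$ be the set of $i$-dimensional singular subspaces of $\Delta$. Then $|\Delta_i|=\delta_{n,s,t}(i)$, where $$\delta_{n,s,t}(i)=\frac{\prod_{u=0}^{i}(s^{n-u-1}t+1)\cdot\prod_{u=0}^{i}(s^{n-u}-1)}{\prod_{u=0}^{i}(s^{u+1}-1)} .$$ Moreover, for all integers $n>2$, $s>1$, $t\geq 1$ with $t\in\{1,s^{1/2},s,s^{3/2},s^2\}$, put $$i_{\max}=\begin{cases}\lfloor(2n-2+\log_s t)/3\rfloor & \text{if } t\le s,\\ \lceil(2n-2+\log_s t)/3\rceil-1 & \text{if } s<t.\end{cases}$$ Then $0\le i_{\max}\le n-1$, and the following hold for the function $\delta_{n,s,t}$ on $\{0,1,\dots,n-1\}$. (1) If $s\ne t$, or $s=t$ and $3\nmid 2n-1$, then $\delta_{n,s,t}$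 attains its maximum value at $i_{\max}$, it is strictly increasing on $\{0,1,\dots,i_{\max}\}$ and strictly decreasing on $\{i_{\max},\dots,n-1\}$. (2) If $s=t$ and $2n\equiv 1\pmod 3$, then $i_{\max}\ge 1$ and $\delta_{n,s,s}(i_{\max}-1)=\delta_{n,s,s}(i_{\max})$; the function $\delta_{n,s,s}$ attains its maximum value at both $i_{\max}-1$ and $i_{\max}$, it is strictly increasing on $\{0,1,\dots,i_{\max}-1\}$ and strictly decreasing on $\{i_{\max},\dots,n-1\}$. -/

import Mathlib

universe u

/-- A point-line geometry (partial linear space): lines are sets of at least two points, and two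
distinct points lie on at most one common line. -/
structure PointLineGeometry (P : Type u) where
  lines : Set (Set P)
  nontrivial_of_mem : ∀ L ∈ lines, L.Nontrivial
  eq_of_two_points : ∀ L ∈ lines, ∀ M ∈ lines, ∀ p q : P, p ≠ q →
    p ∈ L → q ∈ L → p ∈ M → q ∈ M → L = M

namespace PointLineGeometry

variable {P : Type u} (G : PointLineGeometry P)

/-- The relation `p ⊥ q`: the points `p` and `q` are equal or lie on a common line. -/
def Perp (p q : P) : Prop := p = q ∨ ∃ L ∈ G.lines, p ∈ L ∧ q ∈ L

/-- A subspace contains every line of which it contains two distinct points. -/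
def IsSubspace (X : Set P) : Prop :=
  ∀ L ∈ G.lines, ∀ p q : P, p ≠ q → p ∈ L → q ∈ L → p ∈ X → q ∈ X → L ⊆ X

/-- A singular subspace is a subspace all of whose points are pairwise collinear.  The type of
singular subspaces is ordered by inclusion; it contains the empty set. -/
abbrev SingularSubspace : Type u :=
  {X : Set P // G.IsSubspace X ∧ ∀ p ∈ X, ∀ q ∈ X, G.Perp p q}

/-- The set `Δ_i` of the singular subspaces of (projective) dimension `i`. Dimension is measured by
chains: `X` has dimension `i` when the longest chains of singular subspaces
`∅ = X₀ ⊂ X₁ ⊂ ⋯ ⊂ X_k = X` that end in `X` have `k = i + 1` steps. So `∅` has dimension `-1`,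
points have dimension `0` and lines have dimension `1`. -/
def subspacesOfDim (i : ℕ) : Set G.SingularSubspace :=
  {X | Order.height X = (i : ℕ∞) + 1}

/-- A (non-degenerate) polar space: a point off a line is collinear with exactly one or with all
points of the line, and no point is collinear with all points. -/
structure IsPolarSpace : Prop where
  one_or_all : ∀ L ∈ G.lines, ∀ p ∉ L,
    (∃! q, q ∈ L ∧ G.Perp p q) ∨ (∀ q ∈ L, G.Perp p q)
  nondegenerate : ∀ p : P, ∃ q : P, ¬ G.Perp p q

/-- `G` has rank `n`: the longest chains of singular subspaces `∅ = X₀ ⊂ X₁ ⊂ ⋯ ⊂ X_n` have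
`n` steps, that is, the maximal dimension of a singular subspace is `n - 1`. -/
def HasRank (n : ℕ) : Prop := Order.krullDim G.SingularSubspace = (n : WithBot ℕ∞)

/-- `G`, of rank `n ≥ 2`, has order `(s, …, s, t)`: all lines have `s + 1` points and every
singular subspace of dimension `n - 2` is contained in exactly `t + 1` singular subspaces of
dimension `n - 1`. -/
structure HasOrder (n s t : ℕ) : Prop where
  card_line : ∀ L ∈ G.lines, L.ncard = s + 1
  card_maximal : ∀ X ∈ G.subspacesOfDim (n - 2),
    {Y | Y ∈ G.subspacesOfDim (n - 1) ∧ X ≤ Y}.ncard = t + 1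

end PointLineGeometry

/-- The product formula
`δ_{n,s,t}(i) = ∏_{u=0}^i (s^{n-u-1} t + 1) · ∏_{u=0}^i (s^{n-u} - 1) / ∏_{u=0}^i (s^{u+1} - 1)`,
meaningful for `i ≤ n - 1`. -/
noncomputable def polarDelta (n s t i : ℕ) : ℝ :=
  (∏ u ∈ Finset.range (i + 1), ((s : ℝ) ^ (n - u - 1) * t + 1)) *
      (∏ u ∈ Finset.range (i + 1), ((s : ℝ) ^ (n - u) - 1)) /
    ∏ u ∈ Finset.range (i + 1), ((s : ℝ) ^ (u + 1) - 1)

/-- The index `i_max`. For `n ≥ 3`, `s ≥ 2`, `t ≥ 1` the number `(2n - 2 + log_s t) / 3` is greater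
than `1`, so that the natural-number floor, ceiling and subtraction are the usual ones. -/
noncomputable def polarIMax (n s t : ℕ) : ℕ :=
  if t ≤ s then ⌊(2 * (n : ℝ) - 2 + Real.logb s t) / 3⌋₊
  else ⌈(2 * (n : ℝ) - 2 + Real.logb s t) / 3⌉₊ - 1

/-! Counting. Let `x`, `y` be non-collinear points. Each line through `x` has exactly one point in
`y^⊥`, so `x^⊥ ∩ y^⊥` is a model of the geometry of lines through `x`: a polar space of rank one
less with the same `s` and `t` (`IsRegular.commonPerp`), whose singular subspaces correspond, by
coning from `x`, to those through `x` (`IsPolarSpace.bijOn_cone`). The same device shows that a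
singular subspace of dimension `k - 1` has `1 + s + ⋯ + s^(k-1)` points, yields a recursion for the
number of points (`IsRegular.card_points`), and, by counting incident pairs (point, subspace), the
product formula (`IsRegular.ncard_singularOfRank`). The delicate point is that a cone over a
singular subspace is again a subspace (`isSingular_cone`); this follows from the one-or-all axiom by
separating points from singular subspaces by perps (`exists_perp_not_perp`).

Shape. With `e = n - i - 2`, the quotient of consecutive values is `δ(i+1)/δ(i) = (s^e t +
1)(s^(e+1) - 1)/(s^(i+2) - 1)`, so `s^(i+2) + s^e t` is compared with `s^(2e+1) t + s^(e+1)`. The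
dominant terms `s^(i+2)` and `s^(2e+1) t` are ordered as `i + 1` and `(2n - 2 + log_s t)/3`. If they
differ, they do so by a factor of at least two (`two_mul_le_of_lt`), which absorbs the lower terms.
If they tie, the lower terms decide by the order of `s` and `t`: hence floor against ceiling, and
equality exactly when also `s = t`. -/

namespace PointLineGeometry

/-! ### Collinearity, singular subspaces and induced geometries -/

variable {P : Type u} {G : PointLineGeometry P}

/-- A singular subspace, as a predicate on sets of points. -/
def IsSingular (G : PointLineGeometry P) (X : Set P) : Prop :=
  G.IsSubspace X ∧ ∀ p ∈ X, ∀ q ∈ X, G.Perp p q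

/-- The geometry induced on a set `Q` of points: its lines are the lines contained in `Q`. -/
def restrict (G : PointLineGeometry P) (Q : Set P) : PointLineGeometry Q where
  lines := {L | Subtype.val '' L ∈ G.lines}
  nontrivial_of_mem _ hL := Set.nontrivial_of_image _ _ (G.nontrivial_of_mem _ hL)
  eq_of_two_points _ hL _ hM p q hpq hpL hqL hpM hqM :=
    Subtype.val_injective.image_injective <|
      G.eq_of_two_points _ hL _ hM p q (fun h => hpq (Subtype.ext h))
        ⟨p, hpL, rfl⟩ ⟨q, hqL, rfl⟩ ⟨p, hpM, rfl⟩ ⟨q, hqM, rfl⟩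

/-- The points collinear with both `x` and `y`. -/
def commonPerp (G : PointLineGeometry P) (x y : P) : Set P := {z | G.Perp z x ∧ G.Perp z y}

/-- The union of the lines that join `x` to a point of `A`, together with `x`. -/
def cone (G : PointLineGeometry P) (x : P) (A : Set P) : Set P :=
  {w | w = x ∨ ∃ a ∈ A, ∃ L ∈ G.lines, x ∈ L ∧ a ∈ L ∧ w ∈ L}

theorem Perp.refl (p : P) : G.Perp p p := Or.inl rfl

theorem Perp.symm {p q : P} (h : G.Perp p q) : G.Perp q p := by
  rcases h with h | ⟨L, hL, hp, hq⟩
  · exact Or.inl h.symm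
  · exact Or.inr ⟨L, hL, hq, hp⟩

theorem perp_of_mem_line {L : Set P} (hL : L ∈ G.lines) {p q : P} (hp : p ∈ L) (hq : q ∈ L) :
    G.Perp p q := Or.inr ⟨L, hL, hp, hq⟩

theorem Perp.exists_line {p q : P} (h : G.Perp p q) (hpq : p ≠ q) :
    ∃ L ∈ G.lines, p ∈ L ∧ q ∈ L := h.resolve_left hpq

theorem isSubspace_inter {X Y : Set P} (hX : G.IsSubspace X) (hY : G.IsSubspace Y) :
    G.IsSubspace (X ∩ Y) := fun L hL p q hpq hp hq hpX hqX =>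
  Set.subset_inter (hX L hL p q hpq hp hq hpX.1 hqX.1) (hY L hL p q hpq hp hq hpX.2 hqX.2)

theorem IsSingular.inter {X Y : Set P} (hX : G.IsSingular X) (hY : G.IsSubspace Y) :
    G.IsSingular (X ∩ Y) :=
  ⟨isSubspace_inter hX.1 hY, fun p hp q hq => hX.2 p hp.1 q hq.1⟩

theorem isSingular_empty : G.IsSingular ∅ :=
  ⟨fun _ _ _ _ _ _ _ h => h.elim, fun _ h => h.elim⟩

theorem isSingular_singleton (x : P) : G.IsSingular {x} := by
  refine ⟨fun L _ p q hpq _ _ hp hq => ?_, ?_⟩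
  · rw [Set.mem_singleton_iff] at hp hq
    exact absurd (hp.trans hq.symm) hpq
  · rintro p rfl q rfl
    exact Perp.refl _

section restrict

variable {Q : Set P}

theorem image_preimage_of_subset {X : Set P} (h : X ⊆ Q) :
    Subtype.val '' (Subtype.val ⁻¹' X : Set Q) = X := by
  rw [Subtype.image_preimage_coe, Set.inter_eq_right.2 h]

theorem restrict_perp (hQ : G.IsSubspace Q) {p q : Q} :
    (G.restrict Q).Perp p q ↔ G.Perp p q := by
  constructor
  · rintro (h | ⟨L, hL, hp, hq⟩)
    · exact Or.inl (congrArg _ h)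
    · exact Or.inr ⟨_, hL, ⟨p, hp, rfl⟩, ⟨q, hq, rfl⟩⟩
  · intro h
    by_cases hpq : p = q
    · exact Or.inl hpq
    obtain ⟨L, hL, hp, hq⟩ := h.exists_line fun h => hpq (Subtype.ext h)
    have hLQ : L ⊆ Q :=
      hQ L hL p q (fun h => hpq (Subtype.ext h)) hp hq p.2 q.2
    refine Or.inr ⟨Subtype.val ⁻¹' L, ?_, hp, hq⟩
    change Subtype.val '' _ ∈ G.lines
    rwa [image_preimage_of_subset hLQ]

theorem IsSingular.preimage {X : Set P} (hX : G.IsSingular X) (hQ : G.IsSubspace Q) :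
    (G.restrict Q).IsSingular (Subtype.val ⁻¹' X) := by
  refine ⟨fun L hL p q hpq hp hq hpX hqX r hr => ?_, fun p hp q hq => ?_⟩
  · exact hX.1 _ hL p q (fun h => hpq (Subtype.ext h)) ⟨p, hp, rfl⟩ ⟨q, hq, rfl⟩ hpX hqX
      ⟨r, hr, rfl⟩
  · exact (restrict_perp hQ).2 (hX.2 _ hp _ hq)

theorem IsSingular.image {X : Set Q} (hX : (G.restrict Q).IsSingular X) (hQ : G.IsSubspace Q) :
    G.IsSingular (Subtype.val '' X) := by
  refine ⟨?_, ?_⟩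
  · rintro L hL _ _ hpq hp hq ⟨p, hpX, rfl⟩ ⟨q, hqX, rfl⟩
    have hLQ : L ⊆ Q := hQ L hL p q hpq hp hq p.2 q.2
    have := hX.1 (Subtype.val ⁻¹' L)
      (by change Subtype.val '' _ ∈ G.lines; rwa [image_preimage_of_subset hLQ]) p q
      (fun h => hpq (congrArg _ h)) hp hq hpX hqX
    intro r hr
    exact ⟨⟨r, hLQ hr⟩, this hr, rfl⟩
  · rintro _ ⟨p, hp, rfl⟩ _ ⟨q, hq, rfl⟩
    exact (restrict_perp hQ).1 (hX.2 p hp q hq)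

end restrict

/-! ### Perps and cones in polar spaces -/

namespace IsPolarSpace

theorem perp_of_perp_two (hG : G.IsPolarSpace) {L : Set P} (hL : L ∈ G.lines) {p a b c : P}
    (hab : a ≠ b) (ha : a ∈ L) (hb : b ∈ L) (hc : c ∈ L) (hpa : G.Perp p a) (hpb : G.Perp p b) :
    G.Perp p c := by
  by_cases hp : p ∈ L
  · exact perp_of_mem_line hL hp hc
  rcases hG.one_or_all L hL p hp with h | h
  · exact absurd (h.unique ⟨ha, hpa⟩ ⟨hb, hpb⟩) hab
  · exact h c hc

theorem exists_perp_mem_line (hG : G.IsPolarSpace) {L : Set P} (hL : L ∈ G.lines) (p : P) :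
    ∃ q ∈ L, G.Perp q p := by
  by_cases hp : p ∈ L
  · exact ⟨p, hp, Perp.refl p⟩
  rcases hG.one_or_all L hL p hp with h | h
  · obtain ⟨q, hq⟩ := h.exists
    exact ⟨q, hq.1, hq.2.symm⟩
  · obtain ⟨q, hq⟩ := (G.nontrivial_of_mem L hL).nonempty
    exact ⟨q, hq, (h q hq).symm⟩

theorem isSubspace_perp (hG : G.IsPolarSpace) (x : P) : G.IsSubspace {z | G.Perp z x} :=
  fun _ hL _ _ hpq hp hq hpx hqx _ hr =>
    (hG.perp_of_perp_two hL hpq hp hq hr (Perp.symm hpx) (Perp.symm hqx)).symm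

theorem isSubspace_commonPerp (hG : G.IsPolarSpace) (x y : P) :
    G.IsSubspace (G.commonPerp x y) :=
  isSubspace_inter (hG.isSubspace_perp x) (hG.isSubspace_perp y)

/-- If `a ≠ b`, everything collinear with `a` is collinear with the whole line `ab`. A point `c` of
that line, together with a point `e` not collinear with `c`, then contradicts the one-or-all axiom.
-/
theorem eq_of_perp_subset (hG : G.IsPolarSpace) {a b : P}
    (h : ∀ z, G.Perp z a → G.Perp z b) : a = b := by
  by_contra hab
  obtain ⟨L, hL, haL, hbL⟩ := (h a (Perp.refl a)).exists_line hab
  obtain ⟨q, hq⟩ := hG.nondegenerate b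
  obtain ⟨c, hcL, hcq⟩ := hG.exists_perp_mem_line hL q
  have hL' : ∀ z, G.Perp z a → ∀ w ∈ L, G.Perp z w := fun z hz w hw =>
    hG.perp_of_perp_two hL hab haL hbL hw hz (h z hz)
  have hcb : c ≠ b := by rintro rfl; exact hq hcq
  have hca : c ≠ a := by rintro rfl; exact hq (h q hcq.symm).symm
  have hcq' : c ≠ q := by rintro rfl; exact hq (perp_of_mem_line hL hbL hcL)
  obtain ⟨e, he⟩ := hG.nondegenerate c
  obtain ⟨K, hK, hcK, hqK⟩ := hcq.exists_line hcq'
  obtain ⟨f, hfK, hfe⟩ := hG.exists_perp_mem_line hK e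
  have hfc : f ≠ c := by rintro rfl; exact he hfe
  have hfc' : G.Perp f c := perp_of_mem_line hK hfK hcK
  have hfe' : f ≠ e := by rintro rfl; exact he hfc'.symm
  obtain ⟨E, hE, hfE, heE⟩ := hfe.exists_line hfe'
  obtain ⟨k, hkE, hka⟩ := hG.exists_perp_mem_line hE a
  -- Either `f` is collinear with `a`, hence with `b`, which makes `b` collinear with `q`; or `c` is
  -- collinear with two points of the line `E`, hence with `e`.
  by_cases hfk : f = k
  · subst hfk
    exact hq (hG.perp_of_perp_two hK hfc hfK hcK hqK (h f hka).symm
      (perp_of_mem_line hL hbL hcL))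
  · exact he (hG.perp_of_perp_two hE hfk hfE hkE heE hfc'.symm (hL' k hka c hcL).symm)

theorem isPolarSpace_commonPerp (hG : G.IsPolarSpace) {x y : P} (hxy : ¬ G.Perp x y) :
    (G.restrict (G.commonPerp x y)).IsPolarSpace := by
  have hQ := hG.isSubspace_commonPerp x y
  refine ⟨fun L hL p hp => ?_, fun p => ?_⟩
  · rcases hG.one_or_all _ hL p (by rintro ⟨q, hq, h⟩; exact hp (Subtype.ext h ▸ hq)) with h | h
    · left
      obtain ⟨_, ⟨⟨q, hq, rfl⟩, hpq⟩, hu⟩ := h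
      refine ⟨q, ⟨hq, (restrict_perp hQ).2 hpq⟩, fun r hr => Subtype.ext ?_⟩
      exact hu r ⟨⟨r, hr.1, rfl⟩, (restrict_perp hQ).1 hr.2⟩
    · right
      exact fun q hq => (restrict_perp hQ).2 (h q ⟨q, hq, rfl⟩)
  · by_contra! hp
    have hp' : ∀ q ∈ G.commonPerp x y, G.Perp p q := fun q hq =>
      (restrict_perp hQ).1 (hp ⟨q, hq⟩)
    -- Lines through `x` meet `y^⊥` inside the common perp, so a point `p` of its radical is
    -- collinear with two points of each of them: `x^⊥ ⊆ p^⊥`.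
    have : x = p := by
      refine hG.eq_of_perp_subset fun z hz => ?_
      by_cases hzx : z = x
      · exact hzx ▸ p.2.1.symm
      obtain ⟨L, hL, hzL, hxL⟩ := hz.exists_line hzx
      obtain ⟨q, hqL, hqy⟩ := hG.exists_perp_mem_line hL y
      have hqx : q ≠ x := by rintro rfl; exact hxy hqy
      exact (hG.perp_of_perp_two hL hqx hqL hxL hzL
        (hp' q ⟨perp_of_mem_line hL hqL hxL, hqy⟩) p.2.1).symm
    exact hxy (this ▸ p.2.2)

/-- A singular subspace is determined by its perp: points outside it can be separated from it. -/
theorem exists_perp_not_perp [Finite P] (hG : G.IsPolarSpace) {X : Set P} (hX : G.IsSingular X)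
    {c : P} (hc : c ∉ X) : ∃ z, (∀ x ∈ X, G.Perp z x) ∧ ¬ G.Perp z c := by
  induction hk : X.ncard using Nat.strong_induction_on generalizing P with
  | _ k ih =>
    subst hk
    by_cases hcX : ∃ x ∈ X, ¬ G.Perp x c
    · obtain ⟨x, hx, hxc⟩ := hcX
      exact ⟨x, fun w hw => hX.2 x hx w hw, hxc⟩
    push Not at hcX
    rcases X.eq_empty_or_nonempty with rfl | ⟨a, ha⟩
    · obtain ⟨z, hz⟩ := hG.nondegenerate c
      exact ⟨z, by simp, fun h => hz h.symm⟩
    obtain ⟨b, hab⟩ := hG.nondegenerate a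
    have hQ := hG.isSubspace_commonPerp a b
    have hac : a ≠ c := by rintro rfl; exact hc ha
    obtain ⟨K, hK, haK, hcK⟩ := (hcX a ha).exists_line hac
    -- Projecting from `a` into `a^⊥ ∩ b^⊥` replaces `c` by `d` and removes at least `a` from `X`. A
    -- point collinear with `a` and `c` would be collinear with `d`, so separating `d` separates
    -- `c`.
    obtain ⟨d, hdK, hdb⟩ := hG.exists_perp_mem_line hK b
    have hda : d ≠ a := by rintro rfl; exact hab hdb
    have hdX : d ∉ X := fun h => hc (hX.1 K hK d a hda hdK haK h ha hcK)
    have hlt : (Subtype.val ⁻¹' X : Set (G.commonPerp a b)).ncard < X.ncard := by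
      rw [← Set.ncard_image_of_injective _ Subtype.val_injective]
      refine Set.ncard_lt_ncard ⟨by simp, fun h => ?_⟩ (Set.toFinite _)
      obtain ⟨w, -, hw⟩ := h ha
      exact hab (hw ▸ w.2.2)
    obtain ⟨z, hzX, hzd⟩ := ih _ hlt (hG.isPolarSpace_commonPerp hab) (hX.preimage hQ)
      (c := ⟨d, perp_of_mem_line hK hdK haK, hdb⟩) hdX rfl
    refine ⟨z, fun x hx => ?_, fun h => hzd ((restrict_perp hQ).2 ?_)⟩
    · by_cases hxa : x = a
      · exact hxa ▸ z.2.1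
      obtain ⟨L, hL, hxL, haL⟩ := (hX.2 x hx a ha).exists_line hxa
      obtain ⟨w, hwL, hwb⟩ := hG.exists_perp_mem_line hL b
      have hwa : w ≠ a := by rintro rfl; exact hab hwb
      have hwX := hX.1 L hL x a hxa hxL haL hx ha hwL
      refine hG.perp_of_perp_two hL hwa hwL haL hxL ?_ z.2.1
      exact (restrict_perp hQ).1 (hzX ⟨w, perp_of_mem_line hL hwL haL, hwb⟩ hwX)
    · exact hG.perp_of_perp_two hK hac haK hcK hdK z.2.1 h

theorem perp_of_mem_cone (hG : G.IsPolarSpace) {x : P} {A : Set P} (hxA : x ∉ A) {z : P}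
    (hzx : G.Perp z x) (hzA : ∀ a ∈ A, G.Perp z a) {w : P} (hw : w ∈ G.cone x A) :
    G.Perp z w := by
  rcases hw with rfl | ⟨a, ha, L, hL, hxL, haL, hwL⟩
  · exact hzx
  · exact hG.perp_of_perp_two hL (by rintro rfl; exact hxA ha) hxL haL hwL hzx (hzA a ha)

/-- Closure under lines is the issue. Choose `y` collinear with all of `X` but not with `x`, so that
`X ⊆ x^⊥ ∩ y^⊥`, and project a point `w` of a line joining two cone points from `x` to a point `d`
there. If `d ∉ X`, some `z` in the common perp is collinear with `X` but not with `d`; yet `z` is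
collinear with the whole cone, hence with `w` and `d`. -/
theorem isSingular_cone [Finite P] (hG : G.IsPolarSpace) {X : Set P} (hX : G.IsSingular X)
    {x : P} (hx : x ∉ X) (hxX : ∀ a ∈ X, G.Perp x a) : G.IsSingular (G.cone x X) := by
  have hcx : ∀ w ∈ G.cone x X, G.Perp w x := fun w hw =>
    (hG.perp_of_mem_cone hx (Perp.refl x) hxX hw).symm
  have hcX : ∀ w ∈ G.cone x X, ∀ a ∈ X, G.Perp w a := fun w hw a ha =>
    (hG.perp_of_mem_cone hx (hxX a ha).symm (fun b hb => hX.2 a ha b hb) hw).symm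
  refine ⟨fun L hL p q hpq hp hq hpX hqX w hw => ?_, fun p hp q hq =>
    hG.perp_of_mem_cone hx (hcx p hp) (hcX p hp) hq⟩
  by_cases hwx : w = x
  · exact Or.inl hwx
  obtain ⟨y, hyX, hyx⟩ := hG.exists_perp_not_perp hX hx
  have hQ := hG.isSubspace_commonPerp x y
  have hxw : G.Perp x w := hG.perp_of_perp_two hL hpq hp hq hw (hcx p hpX).symm (hcx q hqX).symm
  obtain ⟨K, hK, hxK, hwK⟩ := hxw.exists_line (Ne.symm hwx)
  obtain ⟨d, hdK, hdy⟩ := hG.exists_perp_mem_line hK y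
  by_cases hdX : d ∈ X
  · exact Or.inr ⟨d, hdX, K, hK, hxK, hdK, hwK⟩
  obtain ⟨z, hzX, hzd⟩ := (hG.isPolarSpace_commonPerp fun h => hyx h.symm).exists_perp_not_perp
    (hX.preimage hQ) (c := ⟨d, perp_of_mem_line hK hdK hxK, hdy⟩) hdX
  have hzX' : ∀ a ∈ X, G.Perp z a := fun a ha =>
    (restrict_perp hQ).1 (hzX ⟨a, (hxX a ha).symm, (hyX a ha).symm⟩ ha)
  have hzp : G.Perp z p := hG.perp_of_mem_cone hx z.2.1 hzX' hpX
  have hzq : G.Perp z q := hG.perp_of_mem_cone hx z.2.1 hzX' hqX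
  have hzw := hG.perp_of_perp_two hL hpq hp hq hw hzp hzq
  exact absurd ((restrict_perp hQ).2 (hG.perp_of_perp_two hK (Ne.symm hwx) hxK hwK hdK z.2.1 hzw))
    hzd

end IsPolarSpace

end PointLineGeometry

/-! ### Sizes and dimensions of singular subspaces -/

namespace PointLineGeometry

variable {P : Type u} {G : PointLineGeometry P}

/-- The number of points of a projective space of vector space dimension `k` over a field with `s`
elements. -/
def gaussNumber (s k : ℕ) : ℕ := ∑ j ∈ Finset.range k, s ^ j

theorem gaussNumber_zero (s : ℕ) : gaussNumber s 0 = 0 := rfl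

theorem gaussNumber_succ (s k : ℕ) : gaussNumber s (k + 1) = s * gaussNumber s k + 1 := by
  simp [gaussNumber, Finset.sum_range_succ', Finset.mul_sum, pow_succ']

theorem gaussNumber_one (s : ℕ) : gaussNumber s 1 = 1 := by simp [gaussNumber]

theorem gaussNumber_strictMono {s : ℕ} (hs : 0 < s) : StrictMono (gaussNumber s) :=
  strictMono_nat_of_lt_succ fun k => by
    rw [gaussNumber, gaussNumber, Finset.sum_range_succ]
    exact Nat.lt_add_of_pos_right (pow_pos hs k)

theorem gaussNumber_mul_sub_one (s k : ℕ) :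
    (gaussNumber s k : ℝ) * ((s : ℝ) - 1) = (s : ℝ) ^ k - 1 := by
  rw [gaussNumber]
  push_cast
  exact geom_sum_mul _ _

theorem ncard_cone [Finite P] {s : ℕ} (hcard : ∀ L ∈ G.lines, L.ncard = s + 1) {x : P} {A : Set P}
    (hxA : x ∉ A) (hperp : ∀ a ∈ A, G.Perp a x)
    (hA : ∀ a ∈ A, ∀ b ∈ A, ∀ L ∈ G.lines, x ∈ L → a ∈ L → b ∈ L → a = b) :
    (G.cone x A).ncard = s * A.ncard + 1 := by
  classical
  have hline : ∀ a ∈ A, ∃ L ∈ G.lines, x ∈ L ∧ a ∈ L := fun a ha =>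
    (hperp a ha).symm.exists_line (by rintro rfl; exact hxA ha)
  choose! ℓ hℓ hxℓ haℓ using hline
  have hu : ∀ a ∈ A, ∀ L ∈ G.lines, x ∈ L → a ∈ L → L = ℓ a := fun a ha L hL hx haL =>
    G.eq_of_two_points L hL _ (hℓ a ha) x a (by rintro rfl; exact hxA ha) hx haL (hxℓ a ha)
      (haℓ a ha)
  have hfin : ∀ B : Set P, B.Finite := fun B => B.toFinite
  have hcone : G.cone x A = insert x (((hfin A).toFinset.biUnion
      fun a => (hfin (ℓ a \ {x})).toFinset : Finset P) : Set P) := by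
    ext w
    by_cases hw : w = x
    · simp [hw, cone]
    simp only [cone, Set.mem_ofPred_eq, hw, false_or, Set.mem_insert_iff, Finset.mem_coe,
      Finset.mem_biUnion, Set.Finite.mem_toFinset, Set.mem_sdiff, Set.mem_singleton_iff,
      not_false_eq_true, and_true]
    constructor
    · rintro ⟨a, ha, L, hL, hx, haL, hwL⟩
      exact ⟨a, ha, hu a ha L hL hx haL ▸ hwL⟩
    · rintro ⟨a, ha, hwa⟩
      exact ⟨a, ha, ℓ a, hℓ a ha, hxℓ a ha, haℓ a ha, hwa⟩
  rw [hcone, Set.ncard_insert_of_notMem (by simp) (hfin _), Set.ncard_coe_finset,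
    Finset.card_biUnion]
  · have : ∀ a ∈ (hfin A).toFinset, (hfin (ℓ a \ {x})).toFinset.card = s := fun a ha => by
      have ha := (Set.Finite.mem_toFinset _).1 ha
      rw [← Set.ncard_eq_toFinset_card, Set.ncard_sdiff_singleton_of_mem (hxℓ a ha),
        hcard _ (hℓ a ha), Nat.add_sub_cancel]
    rw [Finset.sum_congr rfl this, Finset.sum_const, ← Set.ncard_eq_toFinset_card, smul_eq_mul,
      mul_comm]
  · intro a ha b hb hab
    rw [Finset.mem_coe, Set.Finite.mem_toFinset] at ha hb
    rw [Function.onFun, Finset.disjoint_left]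
    intro w hwa hwb
    simp only [Set.Finite.mem_toFinset, Set.mem_sdiff, Set.mem_singleton_iff] at hwa hwb
    have := G.eq_of_two_points _ (hℓ a ha) _ (hℓ b hb) x w (Ne.symm hwa.2) (hxℓ a ha) hwa.1
      (hxℓ b hb) hwb.1
    exact hab (hA a ha b hb _ (hℓ a ha) (hxℓ a ha) (haℓ a ha) (this ▸ haℓ b hb))

theorem mem_cone_self (x : P) (A : Set P) : x ∈ G.cone x A := Or.inl rfl

theorem subset_cone {x : P} {A : Set P} (hperp : ∀ a ∈ A, G.Perp a x) : A ⊆ G.cone x A := by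
  intro a ha
  by_cases hax : a = x
  · exact Or.inl hax
  · obtain ⟨L, hL, haL, hxL⟩ := (hperp a ha).exists_line hax
    exact Or.inr ⟨a, ha, L, hL, hxL, haL, haL⟩

namespace IsPolarSpace

theorem eq_of_perp_of_mem_line (hG : G.IsPolarSpace) {x y : P} (hxy : ¬ G.Perp x y) {L : Set P}
    (hL : L ∈ G.lines) (hx : x ∈ L) {a b : P} (ha : a ∈ L) (hb : b ∈ L) (hay : G.Perp a y)
    (hby : G.Perp b y) : a = b := by
  by_contra hab
  exact hxy (hG.perp_of_perp_two hL hab ha hb hx hay.symm hby.symm).symm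

/-- A subspace through `x` all of whose points are collinear with `x` is the cone over its
intersection with the perp of a point `y` not collinear with `x`. -/
theorem cone_inter_perp (hG : G.IsPolarSpace) {x y : P} {X : Set P}
    (hX : G.IsSubspace X) (hx : x ∈ X) (hxX : ∀ a ∈ X, G.Perp a x) (hxy : ¬ G.Perp x y) :
    G.cone x (X ∩ {z | G.Perp z y}) = X := by
  ext w
  constructor
  · rintro (rfl | ⟨a, ha, L, hL, hxL, haL, hwL⟩)
    · exact hx
    · exact hX L hL x a (by rintro rfl; exact hxy ha.2) hxL haL hx ha.1 hwL
  · intro hw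
    by_cases hwx : w = x
    · exact Or.inl hwx
    obtain ⟨L, hL, hwL, hxL⟩ := (hxX w hw).exists_line hwx
    obtain ⟨a, haL, hay⟩ := hG.exists_perp_mem_line hL y
    exact Or.inr ⟨a, ⟨hX L hL w x hwx hwL hxL hw hx haL, hay⟩, L, hL, hxL, haL, hwL⟩

theorem ncard_eq_of_inter_perp [Finite P] (hG : G.IsPolarSpace) {s : ℕ}
    (hcard : ∀ L ∈ G.lines, L.ncard = s + 1) {x y : P} {X : Set P}
    (hX : G.IsSubspace X) (hx : x ∈ X) (hxX : ∀ a ∈ X, G.Perp a x) (hxy : ¬ G.Perp x y) :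
    X.ncard = s * (X ∩ {z | G.Perp z y}).ncard + 1 := by
  conv_lhs => rw [← hG.cone_inter_perp hX hx hxX hxy]
  refine ncard_cone hcard (fun h => hxy h.2) (fun a ha => hxX a ha.1) ?_
  intro a ha b hb L hL hxL haL hbL
  exact hG.eq_of_perp_of_mem_line hxy hL hxL haL hbL ha.2 hb.2

theorem ncard_cone_singular [Finite P] {s : ℕ}
    (hcard : ∀ L ∈ G.lines, L.ncard = s + 1) {x : P} {X : Set P}
    (hX : G.IsSingular X) (hx : x ∉ X) (hxX : ∀ a ∈ X, G.Perp a x) :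
    (G.cone x X).ncard = s * X.ncard + 1 := by
  refine ncard_cone hcard hx hxX ?_
  intro a ha b hb L hL hxL haL hbL
  by_contra hab
  exact hx (hX.1 L hL a b hab haL hbL ha hb hxL)

/-- For `x ∈ X` and `y` not collinear with `x`, `X` is the cone from `x` over `X ∩ y^⊥`, which is
the recursion of `gaussNumber`. -/
theorem exists_ncard_eq [Finite P] (hG : G.IsPolarSpace) {s : ℕ}
    (hcard : ∀ L ∈ G.lines, L.ncard = s + 1) {X : Set P} (hX : G.IsSingular X) :
    ∃ k, X.ncard = gaussNumber s k := by
  induction hk : X.ncard using Nat.strong_induction_on generalizing X with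
  | _ k ih =>
    subst hk
    rcases X.eq_empty_or_nonempty with rfl | ⟨x, hx⟩
    · exact ⟨0, by simp [gaussNumber_zero]⟩
    obtain ⟨y, hxy⟩ := hG.nondegenerate x
    have hW := hX.inter (hG.isSubspace_perp y)
    obtain ⟨j, hj⟩ := ih _ (Set.ncard_lt_ncard ⟨Set.inter_subset_left, fun h => hxy (h hx).2⟩
      X.toFinite) hW rfl
    exact ⟨j + 1, by rw [gaussNumber_succ, ← hj,
      hG.ncard_eq_of_inter_perp hcard hX.1 hx (fun a ha => hX.2 a ha x hx) hxy]⟩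

/-- Proper subspaces have fewer points, which bounds chains from above; the hyperplane `X ∩ y^⊥`
realises the next lower height. -/
theorem height_eq [Finite P] (hG : G.IsPolarSpace) {s : ℕ} (hs : 0 < s)
    (hcard : ∀ L ∈ G.lines, L.ncard = s + 1) (X : G.SingularSubspace) {k : ℕ}
    (hX : X.1.ncard = gaussNumber s k) : Order.height X = k := by
  induction k using Nat.strong_induction_on generalizing X with
  | _ k ih =>
    refine le_antisymm ?_ ?_
    · rw [Order.height_le_coe_iff]
      intro Y hY
      have hlt : Y.1.ncard < X.1.ncard := Set.ncard_lt_ncard hY X.1.toFinite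
      obtain ⟨j, hj⟩ := hG.exists_ncard_eq hcard Y.2
      rw [hX, hj, (gaussNumber_strictMono hs).lt_iff_lt] at hlt
      rw [ih j hlt Y hj]
      exact_mod_cast hlt
    · rcases k with _ | k
      · simp
      have hne : X.1.Nonempty := by
        rw [← Set.ncard_pos X.1.toFinite, hX, gaussNumber_succ]
        omega
      obtain ⟨x, hx⟩ := hne
      obtain ⟨y, hxy⟩ := hG.nondegenerate x
      have hW := IsSingular.inter X.2 (hG.isSubspace_perp y)
      have hWk : (X.1 ∩ {z | G.Perp z y}).ncard = gaussNumber s k := by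
        have := hG.ncard_eq_of_inter_perp hcard X.2.1 hx (fun a ha => X.2.2 a ha x hx) hxy
        rw [hX, gaussNumber_succ] at this
        exact (Nat.eq_of_mul_eq_mul_left hs (by omega)).symm
      have hlt : (⟨_, hW⟩ : G.SingularSubspace) < X :=
        ⟨Set.inter_subset_left, fun h => hxy (h hx).2⟩
      have := Order.height_add_one_le hlt
      rw [ih k (Nat.lt_succ_self k) _ hWk] at this
      exact_mod_cast this

theorem height_eq_iff [Finite P] (hG : G.IsPolarSpace) {s : ℕ} (hs : 0 < s)
    (hcard : ∀ L ∈ G.lines, L.ncard = s + 1) (X : G.SingularSubspace) (k : ℕ) :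
    Order.height X = k ↔ X.1.ncard = gaussNumber s k := by
  refine ⟨fun h => ?_, hG.height_eq hs hcard X⟩
  obtain ⟨j, hj⟩ := hG.exists_ncard_eq hcard X.2
  rw [hG.height_eq hs hcard X hj] at h
  rwa [← Nat.cast_inj (R := ℕ∞).1 h]

end IsPolarSpace

/-- The singular subspaces with as many points as a projective space of vector space
dimension `k`. -/
def singularOfRank (G : PointLineGeometry P) (s k : ℕ) : Set (Set P) :=
  {X | G.IsSingular X ∧ X.ncard = gaussNumber s k}

/-- A finite polar space of rank `m + 1` in which all lines have `s + 1` points and each singular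
subspace of rank `m` is contained in exactly `t + 1` singular subspaces of rank `m + 1`. -/
structure IsRegular (G : PointLineGeometry P) (s t m : ℕ) : Prop where
  isPolarSpace : G.IsPolarSpace
  card_line : ∀ L ∈ G.lines, L.ncard = s + 1
  card_le : ∀ X, G.IsSingular X → X.ncard ≤ gaussNumber s (m + 1)
  nonempty : (G.singularOfRank s (m + 1)).Nonempty
  card_above : ∀ X ∈ G.singularOfRank s m,
    {Y | Y ∈ G.singularOfRank s (m + 1) ∧ X ⊆ Y}.ncard = t + 1

/-- Trades chain lengths for point counts, which pass easily to common perps and make sense down to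
rank one, where the induction starts. -/
theorem IsPolarSpace.isRegular [Finite P] (hG : G.IsPolarSpace) {n s t : ℕ} (hs : 0 < s)
    (hr : G.HasRank (n + 2)) (ho : G.HasOrder (n + 2) s t) : G.IsRegular s t (n + 1) := by
  have hle : ∀ X : G.SingularSubspace, Order.height X ≤ ((n + 2 : ℕ) : ℕ∞) := fun X => by
    have := Order.height_le_krullDim X
    rw [hr] at this
    exact WithBot.coe_le_coe.1 this
  have hmem : ∀ (X : G.SingularSubspace) (i : ℕ),
      X ∈ G.subspacesOfDim i ↔ X.1 ∈ G.singularOfRank s (i + 1) := fun X i => by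
    have := hG.height_eq_iff hs ho.card_line X (i + 1)
    push_cast at this
    exact this.trans ⟨fun h => ⟨X.2, h⟩, fun h => h.2⟩
  refine ⟨hG, ho.card_line, fun X hX => ?_, ?_, fun X hX => ?_⟩
  · obtain ⟨k, hk⟩ := hG.exists_ncard_eq ho.card_line hX
    have := hle ⟨X, hX⟩
    rw [hG.height_eq hs ho.card_line ⟨X, hX⟩ hk] at this
    rw [hk]
    exact (gaussNumber_strictMono hs).monotone (by exact_mod_cast this)
  · have h : ((n + 2 : ℕ) : WithBot ℕ∞) ≤ Order.krullDim G.SingularSubspace := hr.ge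
    obtain ⟨l, hl⟩ := Order.le_krullDim_iff.1 h
    have hlast : Order.height l.last = ((n + 2 : ℕ) : ℕ∞) := by
      refine le_antisymm (hle _) ?_
      rw [← hl]
      exact Order.length_le_height_last
    exact ⟨l.last.1, l.last.2, (hG.height_eq_iff hs ho.card_line _ _).1 hlast⟩
  · have := ho.card_maximal ⟨X, hX.1⟩ ((hmem _ _).2 hX)
    rw [← this, ← Set.ncard_image_of_injective _ Subtype.val_injective]
    congr 1
    ext Y
    simp only [Set.mem_ofPred_eq, Set.mem_image]
    constructor
    · rintro ⟨hY, hXY⟩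
      exact ⟨⟨Y, hY.1⟩, ⟨(hmem _ _).2 hY, hXY⟩, rfl⟩
    · rintro ⟨Z, ⟨hZ, hXZ⟩, rfl⟩
      exact ⟨(hmem _ _).1 hZ, hXZ⟩

end PointLineGeometry

/-! ### The residue of a point and the number of points -/

namespace PointLineGeometry

variable {P : Type u} {G : PointLineGeometry P}

theorem cone_mono (x : P) {A B : Set P} (h : A ⊆ B) : G.cone x A ⊆ G.cone x B := by
  rintro w (rfl | ⟨a, ha, hw⟩)
  · exact Or.inl rfl
  · exact Or.inr ⟨a, h ha, hw⟩

section residue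

variable {x y : P}

theorem notMem_image_commonPerp (hxy : ¬ G.Perp x y) (S : Set (G.commonPerp x y)) :
    x ∉ Subtype.val '' S := by
  rintro ⟨a, -, h⟩
  exact hxy (h ▸ a.2.2)

theorem perp_of_mem_image_commonPerp (S : Set (G.commonPerp x y)) :
    ∀ a ∈ Subtype.val '' S, G.Perp a x := by
  rintro _ ⟨a, -, rfl⟩
  exact a.2.1

theorem IsPolarSpace.preimage_cone (hG : G.IsPolarSpace) (hxy : ¬ G.Perp x y)
    (S : Set (G.commonPerp x y)) : Subtype.val ⁻¹' (G.cone x (Subtype.val '' S)) = S := by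
  ext w
  constructor
  · rintro (h | ⟨_, ⟨a, ha, rfl⟩, L, hL, hxL, haL, hwL⟩)
    · exact absurd (h ▸ w.2.2) hxy
    · have := hG.eq_of_perp_of_mem_line hxy hL hxL haL hwL a.2.2 w.2.2
      exact Subtype.ext this ▸ ha
  · intro hw
    exact subset_cone (perp_of_mem_image_commonPerp S) ⟨w, hw, rfl⟩

theorem IsPolarSpace.cone_image_preimage (hG : G.IsPolarSpace) (hxy : ¬ G.Perp x y)
    {X : Set P} (hX : G.IsSingular X) (hx : x ∈ X) :
    G.cone x (Subtype.val '' (Subtype.val ⁻¹' X : Set (G.commonPerp x y))) = X := by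
  conv_rhs => rw [← hG.cone_inter_perp hX.1 hx (fun a ha => hX.2 a ha x hx) hxy]
  congr 1
  rw [Subtype.image_preimage_coe]
  ext w
  exact ⟨fun h => ⟨h.2, h.1.2⟩, fun h => ⟨⟨hX.2 w h.1 x hx, h.2⟩, h.1⟩⟩

theorem IsPolarSpace.isSingular_cone_image [Finite P] (hG : G.IsPolarSpace) (hxy : ¬ G.Perp x y)
    {S : Set (G.commonPerp x y)} (hS : (G.restrict (G.commonPerp x y)).IsSingular S) :
    G.IsSingular (G.cone x (Subtype.val '' S)) :=
  hG.isSingular_cone (hS.image (hG.isSubspace_commonPerp x y)) (notMem_image_commonPerp hxy S)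
    fun a ha => (perp_of_mem_image_commonPerp S a ha).symm

theorem IsPolarSpace.ncard_cone_image [Finite P] (hG : G.IsPolarSpace) (hxy : ¬ G.Perp x y)
    {s : ℕ} (hcard : ∀ L ∈ G.lines, L.ncard = s + 1) {S : Set (G.commonPerp x y)}
    (hS : (G.restrict (G.commonPerp x y)).IsSingular S) :
    (G.cone x (Subtype.val '' S)).ncard = s * S.ncard + 1 := by
  rw [IsPolarSpace.ncard_cone_singular hcard (hS.image (hG.isSubspace_commonPerp x y))
    (notMem_image_commonPerp hxy S) (perp_of_mem_image_commonPerp S),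
    Set.ncard_image_of_injective _ Subtype.val_injective]

/-- The singular subspaces through `x` correspond to those of the geometry on `x^⊥ ∩ y^⊥`. -/
theorem IsPolarSpace.bijOn_cone [Finite P] (hG : G.IsPolarSpace) (hxy : ¬ G.Perp x y)
    {s : ℕ} (hs : 0 < s) (hcard : ∀ L ∈ G.lines, L.ncard = s + 1) (k : ℕ) :
    Set.BijOn (fun S : Set (G.commonPerp x y) => G.cone x (Subtype.val '' S))
      ((G.restrict (G.commonPerp x y)).singularOfRank s k)
      {X | X ∈ G.singularOfRank s (k + 1) ∧ x ∈ X} := by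
  refine ⟨fun S hS => ⟨⟨hG.isSingular_cone_image hxy hS.1, ?_⟩, mem_cone_self x _⟩, ?_, ?_⟩
  · rw [hG.ncard_cone_image hxy hcard hS.1, hS.2, gaussNumber_succ]
  · intro S _ T _ h
    rw [← hG.preimage_cone hxy S, ← hG.preimage_cone hxy T]
    exact congrArg _ h
  · rintro X ⟨⟨hX, hXc⟩, hx⟩
    have hS := hX.preimage (hG.isSubspace_commonPerp x y)
    refine ⟨_, ⟨hS, ?_⟩, hG.cone_image_preimage hxy hX hx⟩
    have := hG.ncard_cone_image hxy hcard hS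
    rw [hG.cone_image_preimage hxy hX hx, hXc, gaussNumber_succ] at this
    exact (Nat.eq_of_mul_eq_mul_left hs (by omega)).symm

/-- All conditions transfer through the cone bijection, once a maximal singular subspace through `x`
is known to exist. -/
theorem IsRegular.commonPerp [Finite P] {s t m : ℕ} (hs : 0 < s) (h : G.IsRegular s t (m + 1))
    (hxy : ¬ G.Perp x y) : (G.restrict (G.commonPerp x y)).IsRegular s t m := by
  have hG := h.isPolarSpace
  refine ⟨hG.isPolarSpace_commonPerp hxy, fun L hL => ?_, fun S hS => ?_, ?_, fun S hS => ?_⟩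
  · rw [← h.card_line _ hL, Set.ncard_image_of_injective _ Subtype.val_injective]
  · have := h.card_le _ (hG.isSingular_cone_image hxy hS)
    rw [hG.ncard_cone_image hxy h.card_line hS, gaussNumber_succ] at this
    exact Nat.le_of_mul_le_mul_left (by omega) hs
  · suffices hM : ∃ M ∈ G.singularOfRank s (m + 1 + 1), x ∈ M by
      obtain ⟨M, hM, hxM⟩ := hM
      obtain ⟨S, hS, -⟩ := (hG.bijOn_cone hxy hs h.card_line (m + 1)).surjOn ⟨hM, hxM⟩
      exact ⟨S, hS⟩
    obtain ⟨M, hM⟩ := h.nonempty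
    by_cases hxM : x ∈ M
    · exact ⟨M, hM, hxM⟩
    by_cases hb : ∃ b ∈ M, ¬ G.Perp b x
    · obtain ⟨b, hbM, hbx⟩ := hb
      -- Both `M` and the new subspace are cones over `M ∩ x^⊥`, with apex `b` and `x` respectively,
      -- so they have equally many points.
      have hW := hM.1.inter (hG.isSubspace_perp x)
      refine ⟨G.cone x (M ∩ {z | G.Perp z x}),
        ⟨hG.isSingular_cone hW (fun h => hxM h.1) fun a ha => ha.2.symm, ?_⟩, mem_cone_self _ _⟩
      rw [IsPolarSpace.ncard_cone_singular h.card_line hW (fun h => hxM h.1) fun a ha => ha.2,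
        ← hG.ncard_eq_of_inter_perp h.card_line hM.1.1 hbM (fun a ha => hM.1.2 a ha b hbM) hbx]
      exact hM.2
    · push Not at hb
      have := h.card_le _ (hG.isSingular_cone hM.1 hxM fun a ha => (hb a ha).symm)
      rw [IsPolarSpace.ncard_cone_singular h.card_line hM.1 hxM hb, hM.2, ← gaussNumber_succ,
        (gaussNumber_strictMono hs).le_iff_le] at this
      omega
  · have hb := hG.bijOn_cone hxy hs h.card_line
    rw [← h.card_above _ ((hb m).mapsTo hS).1]
    refine Set.BijOn.ncard_eq (f := fun S => G.cone x (Subtype.val '' S)) ⟨fun T hT => ?_, ?_, ?_⟩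
    · exact ⟨((hb (m + 1)).mapsTo hT.1).1, cone_mono x (Set.image_mono hT.2)⟩
    · exact (hb (m + 1)).injOn.mono fun T hT => hT.1
    · rintro X ⟨hX, hSX⟩
      obtain ⟨T, hT, rfl⟩ := (hb (m + 1)).surjOn ⟨hX, hSX (mem_cone_self x _)⟩
      refine ⟨T, ⟨hT, ?_⟩, rfl⟩
      rw [← hG.preimage_cone hxy S, ← hG.preimage_cone hxy T]
      exact Set.preimage_mono hSX

end residue

theorem ncard_add_ncard_not [Finite P] (A : Set P) (p : P → Prop) :
    (A ∩ {z | p z}).ncard + (A ∩ {z | ¬ p z}).ncard = A.ncard := by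
  rw [← Set.ncard_union_eq _ (Set.toFinite _) (Set.toFinite _), ← Set.inter_union_distrib_left]
  · congr 1
    ext z
    simp [em]
  · rw [Set.disjoint_left]
    exact fun z h h' => h'.2 h.2

/-- Double counting with sets. -/
theorem ncard_mul_eq_of_biregular {α β : Type*} [Finite α] [Finite β] (r : α → β → Prop)
    {A : Set α} {B : Set β} {a b : ℕ} (ha : ∀ x ∈ A, {y ∈ B | r x y}.ncard = a)
    (hb : ∀ y ∈ B, {x ∈ A | r x y}.ncard = b) : A.ncard * a = B.ncard * b := by
  classical
  have := Fintype.ofFinite α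
  have := Fintype.ofFinite β
  have := Finset.card_mul_eq_card_mul r (s := A.toFinset) (t := B.toFinset) (m := a) (n := b)
    (fun x hx => ?_) fun y hy => ?_
  · rwa [← Set.ncard_eq_toFinset_card', ← Set.ncard_eq_toFinset_card'] at this
  · rw [← ha x (by simpa using hx), ← Set.ncard_coe_finset]
    congr 1
    ext y
    simp [Finset.bipartiteAbove]
  · rw [← hb y (by simpa using hy), ← Set.ncard_coe_finset]
    congr 1
    ext x
    simp [Finset.bipartiteBelow]

/-- The number of points of a polar space of rank `m + 1` and order `(s, …, s, t)`. -/
def pointCount (s t : ℕ) : ℕ → ℕ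
  | 0 => t + 1
  | m + 1 => s * pointCount s t m + 1 + s ^ (2 * (m + 1)) * t

theorem pointCount_mul_sub_one (s t m : ℕ) :
    (pointCount s t m : ℝ) * ((s : ℝ) - 1) = ((s : ℝ) ^ m * t + 1) * ((s : ℝ) ^ (m + 1) - 1) := by
  induction m with
  | zero => simp [pointCount]
  | succ m ih =>
    rw [pointCount]
    push_cast
    linear_combination (s : ℝ) * ih

theorem ncard_singularOfRank_one [Finite P] (s : ℕ) :
    (G.singularOfRank s 1).ncard = Nat.card P := by
  rw [← Set.ncard_univ]
  symm
  refine Set.BijOn.ncard_eq (f := fun x => ({x} : Set P)) ⟨fun x _ => ?_, ?_, ?_⟩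
  · exact ⟨isSingular_singleton x, by simp [gaussNumber_one]⟩
  · exact Set.singleton_injective.injOn
  · rintro X ⟨-, hX⟩
    rw [gaussNumber_one, Set.ncard_eq_one] at hX
    obtain ⟨x, rfl⟩ := hX
    exact ⟨x, trivial, rfl⟩

theorem IsRegular.ncard_perp [Finite P] {s t m : ℕ} (h : G.IsRegular s t m) {x y : P}
    (hxy : ¬ G.Perp x y) : {z | G.Perp z x}.ncard = s * (G.commonPerp x y).ncard + 1 :=
  h.isPolarSpace.ncard_eq_of_inter_perp h.card_line (h.isPolarSpace.isSubspace_perp x)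
    (Perp.refl x) (fun _ ha => ha) hxy

/-- The two counts are proved together: `x^⊥` is the cone over a common perp, and the number of
points not collinear with `x` is `s^2` times its analogue in the common perp. -/
theorem IsRegular.card_points [Finite P] {s t m : ℕ} (hs : 0 < s) (h : G.IsRegular s t m) :
    Nat.card P = pointCount s t m ∧ ∀ x, {z | ¬ G.Perp z x}.ncard = s ^ (2 * m) * t := by
  have hcompl : ∀ x, {z | G.Perp z x}.ncard + {z | ¬ G.Perp z x}.ncard = Nat.card P := fun x => by
    simpa using ncard_add_ncard_not Set.univ fun z => G.Perp z x
  induction m generalizing P with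
  | zero =>
    have hP : Nat.card P = t + 1 := by
      rw [← h.card_above ∅ ⟨isSingular_empty, by simp [gaussNumber_zero]⟩,
        ← ncard_singularOfRank_one (G := G) s]
      simp
    refine ⟨hP, fun x => ?_⟩
    obtain ⟨y, hxy⟩ := h.isPolarSpace.nondegenerate x
    -- In rank one a point collinear with `x` and distinct from it would give a singular subspace
    -- with `s + 1 > 1` points.
    have hQ : G.commonPerp x y = ∅ := by
      rw [Set.eq_empty_iff_forall_notMem]
      rintro z ⟨hzx, hzy⟩
      have hz : z ∉ ({x} : Set P) := by rintro rfl; exact hxy hzy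
      have hzX : ∀ a ∈ ({x} : Set P), G.Perp z a := by rintro a rfl; exact hzx
      have hc := h.card_le _ (h.isPolarSpace.isSingular_cone (isSingular_singleton x) hz hzX)
      rw [IsPolarSpace.ncard_cone_singular h.card_line (isSingular_singleton x) hz
        fun a ha => (hzX a ha).symm, gaussNumber_one, Set.ncard_singleton] at hc
      omega
    have h1 := h.ncard_perp hxy
    have h2 := hcompl x
    rw [hQ, Set.ncard_empty] at h1
    simp only [mul_zero, pow_zero, one_mul]
    omega
  | succ m ih =>
    have hG := h.isPolarSpace
    have hih : ∀ x y, ¬ G.Perp x y → (G.commonPerp x y).ncard = pointCount s t m ∧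
        ∀ q ∈ G.commonPerp x y,
          (G.commonPerp x y ∩ {z | ¬ G.Perp z q}).ncard = s ^ (2 * m) * t := fun x y hxy => by
      obtain ⟨h1, h2⟩ := ih (h.commonPerp hs hxy) fun q => by
        simpa using ncard_add_ncard_not Set.univ
          fun z => (G.restrict (G.commonPerp x y)).Perp z q
      refine ⟨h1, fun q hq => ?_⟩
      rw [← h2 ⟨q, hq⟩, ← Set.ncard_image_of_injective _ Subtype.val_injective]
      congr 1
      ext z
      have := hG.isSubspace_commonPerp x y
      constructor
      · rintro ⟨hz, hzq⟩
        exact ⟨⟨z, hz⟩, fun hp => hzq ((restrict_perp this).1 hp), rfl⟩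
      · rintro ⟨z, hz, rfl⟩
        exact ⟨z.2, fun hp => hz ((restrict_perp this).2 hp)⟩
    have hperp : ∀ x, {z | G.Perp z x}.ncard = s * pointCount s t m + 1 := fun x => by
      obtain ⟨y, hxy⟩ := hG.nondegenerate x
      rw [h.ncard_perp hxy, (hih x y hxy).1]
    have hnot : ∀ x, {z | ¬ G.Perp z x}.ncard = s ^ (2 * (m + 1)) * t := fun x => by
      obtain ⟨y, hxy⟩ := hG.nondegenerate x
      have hN : 0 < pointCount s t m := by
        cases m <;> simp [pointCount]
      -- Counts collinear pairs `(r, q)` with `r` outside `x^⊥` and `q ≠ x` in `x^⊥`. Each `r` sees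
      -- the common perp of `x` and `r`; each `q` sees `q^⊥` minus the cone `q^⊥ ∩ x^⊥`.
      have key := ncard_mul_eq_of_biregular G.Perp (A := {z | ¬ G.Perp z x})
        (B := {z | G.Perp z x} \ {x}) (a := pointCount s t m) (b := s * (s ^ (2 * m) * t)) ?_ ?_
      · rw [Set.ncard_sdiff_singleton_of_mem (by exact Perp.refl x), hperp x,
          Nat.add_sub_cancel] at key
        refine Nat.eq_of_mul_eq_mul_right hN (key.trans ?_)
        ring
      · intro r hr
        rw [← (hih x r fun h => hr h.symm).1]
        congr 1
        ext q
        refine ⟨fun hq => ⟨hq.1.1, hq.2.symm⟩, fun hq => ⟨⟨hq.1, ?_⟩, hq.2.symm⟩⟩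
        rintro rfl
        exact hr hq.2.symm
      · rintro q ⟨hqx, hne⟩
        have hne : q ≠ x := hne
        obtain ⟨L, hL, hqL, hxL⟩ := Perp.exists_line hqx hne
        -- Inside `x^⊥`, the perps of `q` and of the point `q'` of the line `xq` agree, and `q'`
        -- lies in the common perp, where induction applies.
        obtain ⟨q', hqL', hqy'⟩ := hG.exists_perp_mem_line hL y
        have hne' : q' ≠ x := by rintro rfl; exact hxy hqy'
        have hqx' : G.Perp q' x := perp_of_mem_line hL hqL' hxL
        have h1 := ncard_add_ncard_not {z | G.Perp z q} fun z => G.Perp z x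
        have h2 := hG.ncard_eq_of_inter_perp h.card_line
          (isSubspace_inter (hG.isSubspace_perp q) (hG.isSubspace_perp x))
          (x := x) ⟨Perp.symm hqx, Perp.refl x⟩ (fun a ha => ha.2) hxy
        have h3 := ncard_add_ncard_not (G.commonPerp x y) fun z => G.Perp z q'
        rw [(hih x y hxy).1, (hih x y hxy).2 q' ⟨hqx', hqy'⟩] at h3
        have h4 : {z | G.Perp z q} ∩ {z | G.Perp z x} ∩ {z | G.Perp z y} =
            G.commonPerp x y ∩ {z | G.Perp z q'} := by
          ext z
          constructor
          · rintro ⟨⟨hzq, hzx⟩, hzy⟩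
            exact ⟨⟨hzx, hzy⟩, hG.perp_of_perp_two hL hne hqL hxL hqL' hzq hzx⟩
          · rintro ⟨⟨hzx, hzy⟩, hzq⟩
            exact ⟨⟨hG.perp_of_perp_two hL hne' hqL' hxL hqL hzq hzx, hzx⟩, hzy⟩
        have h5 : {z ∈ {z | ¬ G.Perp z x} | G.Perp z q} =
            {z | G.Perp z q} ∩ {z | ¬ G.Perp z x} := by
          ext z
          exact and_comm
        rw [hperp q, h2, h4, ← h3] at h1
        rw [h5]
        linarith
    obtain ⟨M, hM⟩ := h.nonempty
    have hM0 : 0 < M.ncard := by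
      rw [hM.2, gaussNumber_succ]
      omega
    obtain ⟨x, -⟩ := Set.nonempty_of_ncard_ne_zero hM0.ne'
    refine ⟨?_, hnot⟩
    rw [← hcompl x, hperp x, hnot x, pointCount]

end PointLineGeometry

/-! ### Counting singular subspaces -/

theorem polarDelta_zero (m s t : ℕ) : polarDelta (m + 1) s t 0 =
    ((s : ℝ) ^ m * t + 1) * ((s : ℝ) ^ (m + 1) - 1) / ((s : ℝ) - 1) := by
  simp [polarDelta]

theorem polarDelta_succ_succ (m s t k : ℕ) : polarDelta (m + 2) s t (k + 1) =
    ((s : ℝ) ^ (m + 1) * t + 1) * ((s : ℝ) ^ (m + 2) - 1) * polarDelta (m + 1) s t k /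
      ((s : ℝ) ^ (k + 2) - 1) := by
  rw [polarDelta, polarDelta, Finset.prod_range_succ' _ (k + 1), Finset.prod_range_succ' _ (k + 1),
    Finset.prod_range_succ (fun u => (s : ℝ) ^ (u + 1) - 1) (k + 1)]
  have h : ∀ u, m + 2 - (u + 1) = m + 1 - u := fun u => by omega
  simp only [h, Nat.sub_zero]
  rw [mul_div_assoc', div_div]
  congr 1
  ring

namespace PointLineGeometry

variable {P : Type u} {G : PointLineGeometry P}

theorem IsRegular.ncard_singularOfRank [Finite P] {s t m k : ℕ} (hs : 1 < s)
    (h : G.IsRegular s t m) (hk : k ≤ m) :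
    ((G.singularOfRank s (k + 1)).ncard : ℝ) = polarDelta (m + 1) s t k := by
  have hs0 : 0 < s := by omega
  have hs1 : (1 : ℝ) < s := by exact_mod_cast hs
  have hne : (s : ℝ) - 1 ≠ 0 := by linarith
  have hcard := (h.card_points hs0).1
  induction k generalizing P m with
  | zero =>
    rw [zero_add, ncard_singularOfRank_one, hcard, polarDelta_zero, eq_div_iff hne,
      pointCount_mul_sub_one]
  | succ k ih =>
    obtain ⟨m, rfl⟩ : ∃ j, m = j + 1 := ⟨m - 1, by omega⟩
    have hG := h.isPolarSpace
    -- Incident pairs (point, subspace): the subspaces through a point are counted in its residue by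
    -- induction.
    have hkey : (pointCount s t (m + 1) : ℝ) * polarDelta (m + 1) s t k =
        (G.singularOfRank s (k + 1 + 1)).ncard * gaussNumber s (k + 1 + 1) := by
      have hx : ∀ x : P, ({X ∈ G.singularOfRank s (k + 1 + 1) | x ∈ X}.ncard : ℝ) =
          polarDelta (m + 1) s t k := fun x => by
        obtain ⟨y, hxy⟩ := hG.nondegenerate x
        have hQ := h.commonPerp hs0 hxy
        rw [← ih hQ (by omega) (hQ.card_points hs0).1,
          ← (hG.bijOn_cone hxy hs0 h.card_line (k + 1)).ncard_eq]
      have hpos : 0 < Nat.card P := by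
        rw [hcard, pointCount]
        omega
      obtain ⟨x₀⟩ := (Nat.card_pos_iff.1 hpos).1
      have := ncard_mul_eq_of_biregular (fun (x : P) (X : Set P) => x ∈ X) (A := Set.univ)
        (B := G.singularOfRank s (k + 1 + 1))
        (a := {X ∈ G.singularOfRank s (k + 1 + 1) | x₀ ∈ X}.ncard)
        (b := gaussNumber s (k + 1 + 1)) ?_ ?_
      · rw [Set.ncard_univ, hcard] at this
        rw [← hx x₀]
        exact_mod_cast this
      · intro x _
        exact Nat.cast_injective (R := ℝ) ((hx x).trans (hx x₀).symm)
      · intro X hX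
        rw [← hX.2]
        congr 1
        ext z
        simp
    have hden : (s : ℝ) ^ (k + 2) - 1 ≠ 0 := by
      have := one_lt_pow₀ hs1 (n := k + 2) (by omega)
      linarith
    rw [polarDelta_succ_succ, eq_div_iff hden, ← gaussNumber_mul_sub_one, ← mul_assoc, ← hkey,
      ← pointCount_mul_sub_one]
    ring

theorem IsPolarSpace.ncard_subspacesOfDim [Finite P] (hG : G.IsPolarSpace) {n s t : ℕ}
    (hn : 2 ≤ n) (hs : 1 < s) (hr : G.HasRank n) (ho : G.HasOrder n s t) {i : ℕ} (hi : i < n) :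
    ((G.subspacesOfDim i).ncard : ℝ) = polarDelta n s t i := by
  obtain ⟨n, rfl⟩ : ∃ j, n = j + 2 := ⟨n - 2, by omega⟩
  have hs0 : 0 < s := by omega
  rw [← (hG.isRegular hs0 hr ho).ncard_singularOfRank hs (by omega : i ≤ n + 1),
    ← Set.ncard_image_of_injective _ Subtype.val_injective]
  congr 2
  ext X
  have := fun X : G.SingularSubspace => hG.height_eq_iff hs0 ho.card_line X (i + 1)
  push_cast at this
  constructor
  · rintro ⟨Y, hY, rfl⟩
    exact ⟨Y.2, (this Y).1 hY⟩
  · rintro ⟨hX, hXc⟩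
    exact ⟨⟨X, hX⟩, (this _).2 hXc, rfl⟩

end PointLineGeometry

/-! ### Consecutive quotients of the product formula -/

theorem polarDelta_pos {n s t i : ℕ} (hs : 1 < s) (hi : i < n) : 0 < polarDelta n s t i := by
  have hs1 : (1 : ℝ) < s := by exact_mod_cast hs
  have h : ∀ k : ℕ, k ≠ 0 → (0 : ℝ) < (s : ℝ) ^ k - 1 := fun k hk => by
    have := one_lt_pow₀ hs1 hk
    linarith
  refine div_pos (mul_pos (Finset.prod_pos fun u _ => by positivity)
    (Finset.prod_pos fun u hu => h _ ?_)) (Finset.prod_pos fun u _ => h _ u.succ_ne_zero)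
  have := Finset.mem_range.1 hu
  omega

theorem polarDelta_succ (i e s t : ℕ) : polarDelta (i + e + 2) s t (i + 1) =
    polarDelta (i + e + 2) s t i *
      ((((s : ℝ) ^ e * t + 1) * ((s : ℝ) ^ (e + 1) - 1)) / ((s : ℝ) ^ (i + 2) - 1)) := by
  rw [polarDelta, polarDelta, Finset.prod_range_succ _ (i + 1), Finset.prod_range_succ _ (i + 1),
    Finset.prod_range_succ _ (i + 1), show i + e + 2 - (i + 1) - 1 = e by omega,
    show i + e + 2 - (i + 1) = e + 1 by omega, div_mul_div_comm]
  congr 1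
  ring

theorem polarDelta_step {s : ℕ} (hs : 1 < s) (i e t : ℕ) :
    (s ^ (i + 2) + s ^ e * t < s ^ (2 * e + 1) * t + s ^ (e + 1) →
      polarDelta (i + e + 2) s t i < polarDelta (i + e + 2) s t (i + 1)) ∧
    (s ^ (i + 2) + s ^ e * t = s ^ (2 * e + 1) * t + s ^ (e + 1) →
      polarDelta (i + e + 2) s t i = polarDelta (i + e + 2) s t (i + 1)) ∧
    (s ^ (2 * e + 1) * t + s ^ (e + 1) < s ^ (i + 2) + s ^ e * t →
      polarDelta (i + e + 2) s t (i + 1) < polarDelta (i + e + 2) s t i) := by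
  have hpos : 0 < polarDelta (i + e + 2) s t i := polarDelta_pos hs (by omega)
  have hs1 : (1 : ℝ) < s := by exact_mod_cast hs
  have hden : (0 : ℝ) < (s : ℝ) ^ (i + 2) - 1 := by
    have := one_lt_pow₀ hs1 (n := i + 2) (by omega)
    linarith
  have hexp : ((s : ℝ) ^ e * t + 1) * ((s : ℝ) ^ (e + 1) - 1) =
      (s : ℝ) ^ (2 * e + 1) * t + (s : ℝ) ^ (e + 1) - (s : ℝ) ^ e * t - 1 := by ring
  rw [polarDelta_succ, hexp]
  refine ⟨fun h => lt_mul_of_one_lt_right hpos ?_, fun h => ?_, fun h =>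
    mul_lt_of_lt_one_right hpos ?_⟩
  · have h' : (s : ℝ) ^ (i + 2) + (s : ℝ) ^ e * t <
      (s : ℝ) ^ (2 * e + 1) * t + (s : ℝ) ^ (e + 1) := by exact_mod_cast h
    rw [one_lt_div hden]
    linarith
  · have h' : (s : ℝ) ^ (i + 2) + (s : ℝ) ^ e * t =
      (s : ℝ) ^ (2 * e + 1) * t + (s : ℝ) ^ (e + 1) := by exact_mod_cast h
    rw [← h', add_sub_cancel_right, div_self hden.ne', mul_one]
  · have h' : (s : ℝ) ^ (2 * e + 1) * t + (s : ℝ) ^ (e + 1) <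
      (s : ℝ) ^ (i + 2) + (s : ℝ) ^ e * t := by exact_mod_cast h
    rw [div_lt_one hden]
    linarith

/-! ### The index `i_max` as a comparison of powers -/

theorem natCast_le_logb_iff {s t : ℕ} (hs : 1 < s) (ht : 0 < t) (a b : ℕ) :
    (a : ℝ) ≤ b + Real.logb s t ↔ s ^ a ≤ s ^ b * t := by
  have hs1 : (1 : ℝ) < s := by exact_mod_cast hs
  have hs0 : (0 : ℝ) < s := by linarith
  have ht0 : (0 : ℝ) < t := by exact_mod_cast ht
  have h1 : (a : ℝ) = Real.logb s ((s : ℝ) ^ a) := by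
    rw [← Real.rpow_natCast, Real.logb_rpow hs0 hs1.ne']
  have h2 : (b : ℝ) + Real.logb s t = Real.logb s ((s : ℝ) ^ b * t) := by
    rw [Real.logb_mul (by positivity) ht0.ne', ← Real.rpow_natCast, Real.logb_rpow hs0 hs1.ne']
  rw [h1, h2, Real.logb_le_logb hs1 (by positivity) (by positivity)]
  exact_mod_cast Iff.rfl

theorem logb_lt_natCast_iff {s t : ℕ} (hs : 1 < s) (ht : 0 < t) (a b : ℕ) :
    (a : ℝ) < b + Real.logb s t ↔ s ^ a < s ^ b * t := by
  have hs1 : (1 : ℝ) < s := by exact_mod_cast hs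
  have hs0 : (0 : ℝ) < s := by linarith
  have ht0 : (0 : ℝ) < t := by exact_mod_cast ht
  have h1 : (a : ℝ) = Real.logb s ((s : ℝ) ^ a) := by
    rw [← Real.rpow_natCast, Real.logb_rpow hs0 hs1.ne']
  have h2 : (b : ℝ) + Real.logb s t = Real.logb s ((s : ℝ) ^ b * t) := by
    rw [Real.logb_mul (by positivity) ht0.ne', ← Real.rpow_natCast, Real.logb_rpow hs0 hs1.ne']
  rw [h1, h2, Real.logb_lt_logb_iff hs1 (by positivity) (by positivity)]
  exact_mod_cast Iff.rfl

/-- For `n = j + e + 1`, the inequality `3j ≤ 2n - 2 + log_s t` reads `j ≤ 2e + log_s t`. -/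
theorem le_polarIMax_iff_of_le {s t : ℕ} (hs : 1 < s) (ht : 0 < t) (hts : t ≤ s) (j e : ℕ) :
    j ≤ polarIMax (j + e + 1) s t ↔ s ^ j ≤ s ^ (2 * e) * t := by
  have hlog : 0 ≤ Real.logb s t :=
    Real.logb_nonneg (by exact_mod_cast hs) (by exact_mod_cast ht)
  rw [polarIMax, if_pos hts, Nat.le_floor_iff (by
      push_cast
      have h1 : (0 : ℝ) ≤ j := j.cast_nonneg
      have h2 : (0 : ℝ) ≤ e := e.cast_nonneg
      refine div_nonneg ?_ (by norm_num)
      linarith),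
    ← natCast_le_logb_iff hs ht, le_div_iff₀ (by norm_num)]
  push_cast
  constructor <;> intro h <;> linarith

theorem le_polarIMax_iff_of_lt {s t : ℕ} (hs : 1 < s) (hts : s < t) {j : ℕ} (hj : 0 < j)
    (e : ℕ) : j ≤ polarIMax (j + e + 1) s t ↔ s ^ j < s ^ (2 * e) * t := by
  -- Subtraction is truncated, so `c = 0` requires `j` to be positive.
  have hlt : ∀ c : ℕ, j ≤ c - 1 ↔ j < c := fun c => by omega
  rw [polarIMax, if_neg (by omega), hlt, Nat.lt_ceil,
    ← logb_lt_natCast_iff hs (by omega), lt_div_iff₀ (by norm_num)]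
  push_cast
  constructor <;> intro h <;> linarith

theorem polarIMax_lt {n s t : ℕ} (hn : 0 < n) (hs : 1 < s) (ht : 0 < t) (hts : t ≤ s ^ 2) :
    polarIMax n s t < n := by
  have hs1 : (1 : ℝ) < s := by exact_mod_cast hs
  have hn0 : (0 : ℝ) < n := by exact_mod_cast hn
  have hlog : Real.logb s t ≤ 2 := by
    rw [Real.logb_le_iff_le_rpow hs1 (by exact_mod_cast ht)]
    exact_mod_cast hts
  have hT : (2 * (n : ℝ) - 2 + Real.logb s t) / 3 < n := by
    rw [div_lt_iff₀ (by norm_num)]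
    linarith
  rw [polarIMax]
  split_ifs
  · exact (Nat.floor_lt' hn.ne').2 hT
  · have := Nat.ceil_le.2 hT.le
    omega

/-- The powers of `s` and their products with `t` lie a factor of at least two apart. -/
theorem two_mul_le_of_lt {s t : ℕ} (hs : 1 < s)
    (hst : t = 1 ∨ t ^ 2 = s ∨ t = s ∨ t ^ 2 = s ^ 3 ∨ t = s ^ 2) (a b : ℕ) :
    (s ^ a < s ^ b * t → 2 * s ^ a ≤ s ^ b * t) ∧ (s ^ b * t < s ^ a → 2 * (s ^ b * t) ≤ s ^ a) := by
  obtain ⟨c, hc, hodd⟩ : ∃ c, t ^ 2 = s ^ c ∧ (Even c ∨ 4 ≤ s) := by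
    rcases hst with h | h | h | h | h
    · exact ⟨0, by simp [h], Or.inl (by decide)⟩
    · refine ⟨1, by simpa using h, Or.inr ?_⟩
      have : 2 ≤ t := by
        by_contra! ht
        interval_cases t <;> omega
      nlinarith
    · exact ⟨2, by rw [h], Or.inl (by decide)⟩
    · refine ⟨3, h, Or.inr ?_⟩
      by_contra! hs4
      have ht : t < 6 := by
        have : s ^ 3 ≤ 3 ^ 3 := Nat.pow_le_pow_left (by omega) 3
        nlinarith
      interval_cases s <;> interval_cases t <;> omega
    · exact ⟨4, by rw [h]; ring, Or.inl (by decide)⟩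
  -- Here `k` and `l` are exponents of the squared quantities. For even `c` they have equal parity,
  -- so they differ by at least two; otherwise `4 ≤ s` and a difference of one suffices.
  have hgap : ∀ k l, (Even c → ∃ d, l + k = 2 * d + c) → k < l → 4 * s ^ k ≤ s ^ l := by
    intro k l hpar hkl
    rcases hodd with he | hs4
    · obtain ⟨d, hd⟩ := hpar he
      obtain ⟨c', rfl⟩ := he
      calc 4 * s ^ k = 2 ^ 2 * s ^ k := by norm_num
        _ ≤ s ^ 2 * s ^ k := Nat.mul_le_mul_right _ (Nat.pow_le_pow_left hs 2)
        _ = s ^ (2 + k) := (pow_add _ _ _).symm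
        _ ≤ s ^ l := Nat.pow_le_pow_right (by omega) (by omega)
    · calc 4 * s ^ k ≤ s * s ^ k := Nat.mul_le_mul_right _ hs4
        _ = s ^ (k + 1) := (pow_succ' _ _).symm
        _ ≤ s ^ l := Nat.pow_le_pow_right (by omega) hkl
  have hsq1 : (s ^ a) ^ 2 = s ^ (2 * a) := by ring
  have hsq2 : (s ^ b * t) ^ 2 = s ^ (2 * b + c) := by rw [mul_pow, hc]; ring
  constructor
  · intro h
    rw [← Nat.pow_lt_pow_iff_left two_ne_zero, hsq1, hsq2, Nat.pow_lt_pow_iff_right hs] at h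
    rw [← Nat.pow_le_pow_iff_left two_ne_zero, mul_pow, hsq1, hsq2]
    exact hgap _ _ (fun _ => ⟨a + b, by ring⟩) h
  · intro h
    rw [← Nat.pow_lt_pow_iff_left two_ne_zero, hsq1, hsq2, Nat.pow_lt_pow_iff_right hs] at h
    rw [← Nat.pow_le_pow_iff_left two_ne_zero, mul_pow, hsq1, hsq2]
    exact hgap _ _ (fun _ => ⟨a + b, by ring⟩) h

/-! ### Increase before and decrease after `i_max` -/

section steps

variable {n s t : ℕ}

theorem polarDelta_lt_succ (hs : 1 < s) (ht : 0 < t)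
    (hst : t = 1 ∨ t ^ 2 = s ∨ t = s ∨ t ^ 2 = s ^ 3 ∨ t = s ^ 2) {i : ℕ}
    (hi : i + 1 ≤ polarIMax n s t) (hin : i + 1 < n) (hne : s = t → 3 * (i + 1) ≠ 2 * n - 1) :
    polarDelta n s t i < polarDelta n s t (i + 1) := by
  obtain ⟨e, rfl⟩ : ∃ e, n = i + e + 2 := ⟨n - (i + 2), by omega⟩
  refine (polarDelta_step hs i e t).1 ?_
  have e1 : s ^ (i + 2) = s * s ^ (i + 1) := by ring
  have e2 : s ^ (2 * e + 1) * t = s * (s ^ (2 * e) * t) := by ring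
  have e3 : s ^ (e + 1) = s ^ e * s := pow_succ _ _
  have hse : 0 < s ^ e := pow_pos (by omega) _
  rw [show i + e + 2 = i + 1 + e + 1 by ring] at hi
  rcases lt_or_ge s t with hts | hts
  · rw [le_polarIMax_iff_of_lt hs hts (by omega)] at hi
    -- Both `s ^ (i + 2)` and `s ^ e * t` are at most half of `s ^ (2 * e + 1) * t`; the term `s ^
    -- (e + 1)` makes the inequality strict.
    have h1 := Nat.mul_le_mul_left s ((two_mul_le_of_lt hs hst _ _).1 hi)
    have h2 : 2 * (s ^ e * t) ≤ s ^ (2 * e + 1) * t := by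
      calc 2 * (s ^ e * t) ≤ s * (s ^ e * t) := Nat.mul_le_mul_right _ hs
        _ = s ^ (e + 1) * t := by ring
        _ ≤ s ^ (2 * e + 1) * t :=
          Nat.mul_le_mul_right _ (Nat.pow_le_pow_right (by omega) (by omega))
    have h3 : 0 < s ^ (e + 1) := pow_pos (by omega) _
    rw [mul_left_comm, ← e1, ← e2] at h1
    omega
  · rw [le_polarIMax_iff_of_le hs ht hts] at hi
    rcases hts.lt_or_eq with hts | rfl
    · have h1 := Nat.mul_le_mul_left s hi
      have h2 := Nat.mul_lt_mul_of_pos_left hts hse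
      omega
    · have hi' : t ^ (i + 1) < t ^ (2 * e) * t := by
        refine lt_of_le_of_ne hi fun h => ?_
        rw [← pow_succ] at h
        have := Nat.pow_right_injective hs h
        have := hne rfl
        omega
      have h1 := Nat.mul_lt_mul_of_pos_left hi' ht
      omega

theorem polarDelta_succ_lt (hs : 1 < s) (ht : 0 < t)
    (hst : t = 1 ∨ t ^ 2 = s ∨ t = s ∨ t ^ 2 = s ^ 3 ∨ t = s ^ 2) {i : ℕ}
    (hi : polarIMax n s t ≤ i) (hin : i + 1 < n) :
    polarDelta n s t (i + 1) < polarDelta n s t i := by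
  obtain ⟨e, rfl⟩ : ∃ e, n = i + e + 2 := ⟨n - (i + 2), by omega⟩
  refine (polarDelta_step hs i e t).2.2 ?_
  have e1 : s ^ (i + 2) = s * s ^ (i + 1) := by ring
  have e2 : s ^ (2 * e + 1) * t = s * (s ^ (2 * e) * t) := by ring
  have e3 : s ^ (e + 1) = s ^ e * s := pow_succ _ _
  have hse : 0 < s ^ e := pow_pos (by omega) _
  rw [← Nat.lt_succ_iff, ← not_le, Nat.succ_eq_add_one,
    show i + e + 2 = i + 1 + e + 1 by ring] at hi
  rcases lt_or_ge s t with hts | hts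
  · rw [le_polarIMax_iff_of_lt hs hts (by omega), not_lt] at hi
    have h1 := Nat.mul_le_mul_left s hi
    have h2 := Nat.mul_lt_mul_of_pos_left hts hse
    omega
  · rw [le_polarIMax_iff_of_le hs ht hts, not_le] at hi
    -- Again by halves: `s ^ (2 * e + 1) * t` and `s ^ (e + 1)` are each at most half of `s ^ (i +
    -- 2)`.
    have h1 := Nat.mul_le_mul_left s ((two_mul_le_of_lt hs hst _ _).2 hi)
    have h2 : s ^ (e + 1) ≤ s ^ (2 * e + 1) * t := by
      calc s ^ (e + 1) ≤ s ^ (2 * e + 1) := Nat.pow_le_pow_right (by omega) (by omega)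
        _ ≤ s ^ (2 * e + 1) * t := Nat.le_mul_of_pos_right _ ht
    have h3 : 0 < s ^ e * t := Nat.mul_pos hse ht
    rw [mul_left_comm, ← e1, ← e2] at h1
    omega

theorem polarDelta_eq_succ (hs : 1 < s) {i : ℕ} (hi : 3 * (i + 1) = 2 * n - 1) (hin : i + 1 < n) :
    polarDelta n s s i = polarDelta n s s (i + 1) := by
  obtain ⟨e, rfl⟩ : ∃ e, n = i + e + 2 := ⟨n - (i + 2), by omega⟩
  refine (polarDelta_step hs i e s).2.1 ?_
  -- Now both dominant terms are `s ^ (2 * e + 2)` and both lower ones `s ^ (e + 1)`.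
  rw [show i = 2 * e by omega]
  ring

theorem polarIMax_self (hs : 1 < s) {j : ℕ} (hj : 3 * j = 2 * n - 1) (hn : 1 < n) :
    polarIMax n s s = j := by
  refine le_antisymm ?_ ?_
  · by_contra! h
    have hlt := polarIMax_lt (n := n) (t := s) (by omega) hs (by omega)
      (Nat.le_self_pow two_ne_zero s)
    obtain ⟨e, rfl⟩ : ∃ e, n = j + 1 + e + 1 := ⟨n - (j + 2), by omega⟩
    have h' : j + 1 ≤ polarIMax (j + 1 + e + 1) s s := h
    rw [le_polarIMax_iff_of_le hs (by omega) le_rfl, ← pow_succ, Nat.pow_le_pow_iff_right hs] at h'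
    omega
  · obtain ⟨e, rfl⟩ : ∃ e, n = j + e + 1 := ⟨n - (j + 1), by omega⟩
    rw [le_polarIMax_iff_of_le hs (by omega) le_rfl, ← pow_succ, Nat.pow_le_pow_iff_right hs]
    omega

end steps

/-! ### From single steps to monotonicity, and the main theorem -/

theorem strictMonoOn_Icc_zero_of_lt_succ {f : ℕ → ℝ} {m : ℕ}
    (h : ∀ i, i + 1 ≤ m → f i < f (i + 1)) : StrictMonoOn f (Set.Icc 0 m) :=
  strictMonoOn_of_lt_succ Set.ordConnected_Icc fun i _ _ hi => h i hi.2

theorem strictAntiOn_Icc_of_succ_lt {f : ℕ → ℝ} {m k : ℕ}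
    (h : ∀ i, m ≤ i → i + 1 ≤ k → f (i + 1) < f i) : StrictAntiOn f (Set.Icc m k) :=
  strictAntiOn_of_succ_lt Set.ordConnected_Icc fun i _ hi hi' => h i hi.1 hi'.2


theorem mainTheorem5 (n s t : ℕ) (hn : 2 < n) (hs : 1 < s) (ht : 0 < t)
    (hst : t = 1 ∨ t ^ 2 = s ∨ t = s ∨ t ^ 2 = s ^ 3 ∨ t = s ^ 2) :
    -- the product formula gives the numbers of singular subspaces
    (∀ (P : Type u) [Finite P] (Δ : PointLineGeometry P),
      Δ.IsPolarSpace → Δ.HasRank n → Δ.HasOrder n s t →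
        ∀ i < n, ((Δ.subspacesOfDim i).ncard : ℝ) = polarDelta n s t i) ∧
    -- the index `i_max` lies in the domain `{0, …, n - 1}`
    polarIMax n s t < n ∧
    -- the general case
    ((s ≠ t ∨ ¬ 3 ∣ 2 * n - 1) →
      (∀ i < n, polarDelta n s t i ≤ polarDelta n s t (polarIMax n s t)) ∧
      StrictMonoOn (polarDelta n s t) (Set.Icc 0 (polarIMax n s t)) ∧
      StrictAntiOn (polarDelta n s t) (Set.Icc (polarIMax n s t) (n - 1))) ∧
    -- the exceptional case
    ((s = t ∧ 2 * n ≡ 1 [MOD 3]) →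
      1 ≤ polarIMax n s t ∧
      polarDelta n s t (polarIMax n s t - 1) = polarDelta n s t (polarIMax n s t) ∧
      (∀ i < n, polarDelta n s t i ≤ polarDelta n s t (polarIMax n s t)) ∧
      (∀ i < n, polarDelta n s t i ≤ polarDelta n s t (polarIMax n s t - 1)) ∧
      StrictMonoOn (polarDelta n s t) (Set.Icc 0 (polarIMax n s t - 1)) ∧
      StrictAntiOn (polarDelta n s t) (Set.Icc (polarIMax n s t) (n - 1))) := by
  have hts : t ≤ s ^ 2 := by
    rcases hst with h | h | h | h | h
    · exact h ▸ Nat.one_le_pow _ _ (by omega)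
    · nlinarith
    · exact h ▸ Nat.le_self_pow two_ne_zero _
    · rw [← Nat.pow_le_pow_iff_left two_ne_zero, h, ← pow_mul]
      exact Nat.pow_le_pow_right (by omega) (by norm_num)
    · exact h.le
  have hlt := polarIMax_lt (by omega : 0 < n) hs ht hts
  have hanti : StrictAntiOn (polarDelta n s t) (Set.Icc (polarIMax n s t) (n - 1)) :=
    strictAntiOn_Icc_of_succ_lt fun i hi hin => polarDelta_succ_lt hs ht hst hi (by omega)
  have hmax : ∀ i < n, polarIMax n s t ≤ i →
      polarDelta n s t i ≤ polarDelta n s t (polarIMax n s t) := fun i hi hle =>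
    hanti.antitoneOn ⟨le_rfl, by omega⟩ ⟨hle, by omega⟩ hle
  refine ⟨fun P _ Δ hΔ hr ho i hi => hΔ.ncard_subspacesOfDim (by omega) hs hr ho hi, hlt,
    fun h => ?_, ?_⟩
  · have hmono : StrictMonoOn (polarDelta n s t) (Set.Icc 0 (polarIMax n s t)) :=
      strictMonoOn_Icc_zero_of_lt_succ fun i hi =>
        polarDelta_lt_succ hs ht hst hi (by omega) fun hst' h3 =>
          h.elim (fun h => h hst') fun h => h ⟨i + 1, h3.symm⟩
    refine ⟨fun i hi => ?_, hmono, hanti⟩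
    rcases le_total i (polarIMax n s t) with hle | hle
    · exact hmono.monotoneOn ⟨i.zero_le, hle⟩ ⟨Nat.zero_le _, le_rfl⟩ hle
    · exact hmax i hi hle
  · rintro ⟨rfl, hmod⟩
    obtain ⟨k, hk⟩ : ∃ k, 3 * (k + 1) = 2 * n - 1 := by
      unfold Nat.ModEq at hmod
      exact ⟨(2 * n - 1) / 3 - 1, by omega⟩
    have hmono : StrictMonoOn (polarDelta n s s) (Set.Icc 0 k) := by
      refine strictMonoOn_Icc_zero_of_lt_succ fun i hi => ?_
      refine polarDelta_lt_succ hs ht hst ?_ (by omega) fun _ => by omega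
      rw [polarIMax_self hs hk (by omega)]
      omega
    have heq := polarDelta_eq_succ hs hk (by omega)
    rw [polarIMax_self hs hk (by omega)] at hmax hanti ⊢
    have hle : ∀ i < n, polarDelta n s s i ≤ polarDelta n s s (k + 1) := fun i hi => by
      rcases le_or_gt i k with hik | hik
      · exact heq ▸ hmono.monotoneOn ⟨i.zero_le, hik⟩ ⟨Nat.zero_le _, le_rfl⟩ hik
      · exact hmax i hi hik
    exact ⟨by omega, heq, hle, fun i hi => (hle i hi).trans heq.ge, hmono, hanti⟩
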